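/- Throughout, algebras are over $\mathbb{C}$, associative, and need not have an identity. **Definitions.** A *Fréchet algebra* is an algebra $A$ with a complete Hausdorff topology defined by a sequence of seminorms $(p_k)_{k\in\mathbb{N}}$, for which multiplication is continuous. It is *involutive* if it carries a continuous conjugate-linear map $a\mapsto a^*$ with $a^{**}=a$ and $(ab)^*=b^*a^*$. The spectrum $\mathrm{spec}$ of an element is taken after adjunction of an identity. * $A$ is *quasi-symmetric* if there are a C*-algebra $\mathfrak{C}$ and a continuous $*$-homomorphism $\sigma\colon A\to\mathfrak{C}$ such that $\mathrm{spec}_A(a)\subseteq\mathrm{spec}_{\mathfrak{C}}(\sigma(a))$ for every $a\in A$. * Put $e(a)=\sum_{k\ge 1}a^k/k!$. An element $b\in A$ is *polynomially bounded* if $e(i\lambda b)$ converges for every $\lambda\in\mathbb{R}$ and for every $k$ there is a constant $c_k>0$ with $p_k(e(i\lambda b))\le c_k(1+|\lambda|)^{c_k}$ for all $\lambda\in\mathbb{R}$. The algebra $A$ is *polynomially bounded* if the self-adjoint polynomially bounded elements are dense in the set of all self-adjoint elements of $A$. * A *primitive ideal* of $A$ is the kernel of an algebraically irreducible representation $T$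 of $A$ on a complex vector space $V$ (that is, $T\neq 0$, and the only $T(A)$-invariant linear subspaces of $V$ are $0$ and $V$). $\mathrm{Prim}(A)$ is the set of primitive ideals. For $C\subseteq\mathrm{Prim}(A)$ put $\ker(C)=\bigcap_{J\in C}J$ (so $\ker(\emptyset)=A$). $\mathrm{Prim}(A)$ has the hull-kernel topology, in which $C$ is closed if and only if $C=\{J\in\mathrm{Prim}(A): J\supseteq\ker(C)\}$. * $A$ is *semisimple* if the intersection of all its primitive ideals is $0$. * $A$ is *hull-kernel regular* if for every closed $C\subseteq\mathrm{Prim}(A)$ and every $J\in\mathrm{Prim}(A)\setminus C$ there are $a,b\in A$ with $b\in\ker(C)$, $a\notin J$ and $b\cdot a=a$. **Theorem.** Every semisimple, quasi-symmetric, polynomially bounded involutive Fréchet algebra is hull-kernel regular. -/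

import Mathlib

universe u v

namespace HullKernel

section Exponential

variable {A : Type*} [NonUnitalRing A]

/-- `powSucc a n` is the power `a ^ (n + 1)` (in a ring that may have no identity). -/
def powSucc (a : A) : ℕ → A
  | 0 => a
  | n + 1 => powSucc a n * a

variable [Module ℂ A]

/-- The terms of the series `e(a) = ∑_{k ≥ 1} a ^ k / k!`, with `k = n + 1`. -/
noncomputable def expTerm (a : A) (n : ℕ) : A :=
  ((Nat.factorial (n + 1) : ℂ)⁻¹) • powSucc a n

variable [TopologicalSpace A]

/-- `e(a) = ∑_{k ≥ 1} a ^ k / k! = exp a - 1`. -/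
noncomputable def expSubOne (a : A) : A := ∑' n : ℕ, expTerm a n

/-- `b` is polynomially bounded with respect to the seminorms `p k`: every `e(iλb)`, `λ` real,
exists and `p k (e(iλb))` grows at most polynomially in `λ`, for each `k`. -/
def IsPolyBoundedElem (p : ℕ → Seminorm ℂ A) (b : A) : Prop :=
  (∀ t : ℝ, Summable (expTerm ((Complex.I * (t : ℂ)) • b))) ∧
    ∀ k : ℕ, ∃ c : ℝ, 0 < c ∧
      ∀ t : ℝ, p k (expSubOne ((Complex.I * (t : ℂ)) • b)) ≤ c * (1 + |t|) ^ c

/-- The self-adjoint polynomially bounded elements are dense in the space of all self-adjoint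
elements. -/
def IsPolyBoundedAlgebra [StarRing A] (p : ℕ → Seminorm ℂ A) : Prop :=
  {a : A | IsSelfAdjoint a} ⊆ closure {a : A | IsSelfAdjoint a ∧ IsPolyBoundedElem p a}

end Exponential

section QuasiSymmetric

/-- There is a continuous `*`-homomorphism `σ` into a C*-algebra with
`spec (a) ⊆ spec (σ a)` for all `a`. No identities are assumed: the spectra are
taken after adjunction of an identity, which is what Mathlib's `quasispectrum` is
(`Unitization.quasispectrum_eq_spectrum_inr`). -/
def IsQuasiSymmetric (A : Type u) [NonUnitalRing A] [StarRing A] [Module ℂ A]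
    [IsScalarTower ℂ A A] [SMulCommClass ℂ A A] [TopologicalSpace A] : Prop :=
  ∃ (B : Type v) (_ : NonUnitalCStarAlgebra B) (σ : A →⋆ₙₐ[ℂ] B),
    Continuous σ ∧ ∀ a : A, quasispectrum ℂ a ⊆ quasispectrum ℂ (σ a)

end QuasiSymmetric

section Prim

/-- Algebraic irreducibility of a representation: it is not the zero representation and the
only invariant linear subspaces are `0` and `V`. -/
def IsAlgIrreducible {A V : Type*} [NonUnitalRing A] [Module ℂ A]
    [AddCommGroup V] [Module ℂ V] (T : A →ₙₐ[ℂ] Module.End ℂ V) : Prop :=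
  (∃ a, T a ≠ 0) ∧
    ∀ W : Submodule ℂ V, (∀ a : A, ∀ w ∈ W, T a w ∈ W) → W = ⊥ ∨ W = ⊤

variable (A : Type u) [NonUnitalRing A] [Module ℂ A]

/-- A primitive ideal is the kernel of an algebraically irreducible representation. (Each such
representation space is a quotient of `A`, so that one universe suffices.) -/
def IsPrimitiveIdeal {A : Type u} [NonUnitalRing A] [Module ℂ A] (J : TwoSidedIdeal A) : Prop :=
  ∃ (V : Type u) (_ : AddCommGroup V) (_ : Module ℂ V) (T : A →ₙₐ[ℂ] Module.End ℂ V),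
    IsAlgIrreducible T ∧ ∀ a : A, a ∈ J ↔ T a = 0

/-- The set `Prim(A)` of primitive ideals. -/
def Prim : Type u := {J : TwoSidedIdeal A // IsPrimitiveIdeal J}

/-- `A` is semisimple: its Jacobson radical, the intersection of all primitive ideals,
is zero. -/
def IsSemisimpleAlg : Prop := ∀ a : A, (∀ J : Prim A, a ∈ J.1) → a = 0

variable {A}

/-- The kernel `ker(C) = ⋂_{J ∈ C} J` of a set of primitive ideals. -/
def kernel (C : Set (Prim A)) : Set A := {a | ∀ J ∈ C, a ∈ J.1}

/-- The hull of a set of elements: all primitive ideals that contain it. -/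
def hull (S : Set A) : Set (Prim A) := {J | ∀ a ∈ S, a ∈ J.1}

theorem IsAlgIrreducible.exists_apply_ne_zero {V : Type*} [AddCommGroup V] [Module ℂ V]
    {T : A →ₙₐ[ℂ] Module.End ℂ V} (hT : IsAlgIrreducible T) {v : V} (hv : v ≠ 0)
    {y : A} (hy : T y ≠ 0) : ∃ a, T y (T a v) ≠ 0 := by
  by_contra! h
  let N : Submodule ℂ V :=
    { carrier := {w | ∀ a, T y (T a w) = 0}
      zero_mem' := fun a => by simp
      add_mem' := fun {w₁ w₂} h₁ h₂ a => by simp [h₁ a, h₂ a]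
      smul_mem' := fun c w hw a => by simp [hw a] }
  have hN : ∀ a : A, ∀ w ∈ N, T a w ∈ N := fun a w hw b => by
    have := hw (b * a)
    simpa [map_mul] using this
  have hNtop : N = ⊤ := by
    rcases hT.2 N hN with h0 | h1
    · exact absurd ((Submodule.mem_bot ℂ).1 (h0 ▸ (show v ∈ N from h))) hv
    · exact h1
  let K : Submodule ℂ V := LinearMap.ker (T y)
  let R : Submodule ℂ V := Submodule.span ℂ {w | ∃ a x, w = T a x}
  have hR : ∀ a : A, ∀ w ∈ R, T a w ∈ R := fun a w _ => Submodule.subset_span ⟨a, w, rfl⟩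
  have hRK : R ≤ K := Submodule.span_le.2 (by
    rintro _ ⟨a, x, rfl⟩
    have hx : x ∈ N := hNtop ▸ Submodule.mem_top
    exact hx a)
  rcases hT.2 R hR with h0 | h1
  · apply hy
    ext x
    have : T y x ∈ R := Submodule.subset_span ⟨y, x, rfl⟩
    rw [h0] at this
    simpa using this
  · apply hy
    ext x
    have : x ∈ K := hRK (h1 ▸ Submodule.mem_top)
    simpa [K] using this

/-- Primitive ideals are prime. -/
theorem Prim.exists_mul_mul_notMem (J : Prim A) {x y : A} (hx : x ∉ J.1) (hy : y ∉ J.1) :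
    ∃ a, y * (a * x) ∉ J.1 := by
  obtain ⟨V, _, _, T, hT, hJ⟩ := J.2
  rw [hJ] at hx hy
  obtain ⟨w, hw⟩ : ∃ w, T x w ≠ 0 := by
    by_contra! h
    exact hx (LinearMap.ext h)
  obtain ⟨a, ha⟩ := hT.exists_apply_ne_zero hw hy
  refine ⟨a, fun h => ha ?_⟩
  rw [hJ] at h
  simpa [map_mul] using congrArg (fun f => f w) h

/-- The hull-kernel topology on `Prim(A)`: `C` is closed if and only if `C = hull(ker(C))`. -/
instance : TopologicalSpace (Prim A) :=
  TopologicalSpace.ofClosed {C : Set (Prim A) | hull (kernel C) = C}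
    (by
      refine Set.eq_empty_iff_forall_notMem.2 fun J hJ => ?_
      obtain ⟨V, _, _, T, ⟨⟨a, ha⟩, _⟩, hT⟩ := J.2
      exact ha ((hT a).1 (hJ a fun _ h => h.elim)))
    (by
      intro 𝒞 h𝒞
      refine Set.Subset.antisymm (fun J hJ => ?_) (fun J hJ a ha => ha J hJ)
      intro C hC
      rw [← h𝒞 hC]
      exact fun a ha => hJ a fun J' hJ' => ha J' (hJ' C hC))
    (by
      intro C hC D hD
      refine Set.Subset.antisymm (fun J hJ => ?_) (fun J hJ a ha => ha J hJ)
      by_contra hn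
      have h1 : J ∉ hull (kernel C) := fun h => hn (Or.inl (hC ▸ h))
      have h2 : J ∉ hull (kernel D) := fun h => hn (Or.inr (hD ▸ h))
      simp only [hull, Set.mem_ofPred_eq, not_forall] at h1 h2
      obtain ⟨x, hxC, hx⟩ := h1
      obtain ⟨y, hyD, hy⟩ := h2
      obtain ⟨a, ha⟩ := J.exists_mul_mul_notMem hx hy
      refine ha (hJ _ fun J' hJ' => ?_)
      rcases hJ' with h | h
      · exact J'.1.mul_mem_left _ _ (J'.1.mul_mem_left _ _ (hxC J' h))
      · exact J'.1.mul_mem_right _ _ (hyD J' h))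

theorem isClosed_iff_hull_kernel (C : Set (Prim A)) : IsClosed C ↔ hull (kernel C) = C :=
  isOpen_compl_iff.symm.trans
    (iff_of_eq (congrArg (· ∈ {C : Set (Prim A) | hull (kernel C) = C}) (compl_compl C)))

variable (A)

/-- Hull-kernel regularity: for each closed `C ⊆ Prim(A)` and each primitive ideal `J ∉ C` there
are `b ∈ ker(C)` and `a ∉ J` with `b a = a`. -/
def IsHullKernelRegular : Prop :=
  ∀ C : Set (Prim A), IsClosed C → ∀ J : Prim A, J ∉ C →
    ∃ a b : A, b ∈ kernel C ∧ a ∉ J.1 ∧ b * a = a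

end Prim

end HullKernel

open Complex Filter Topology FourierTransform
open scoped ContDiff SchwartzMap

namespace HullKernel

/-! Map `A` by `τ` into a unital C*-algebra so that spectra in `A` lie in spectra of images.
Semisimplicity makes `τ` injective, so identities can be checked in the C*-algebra, and elements of
`A` with small image are quasi-invertible in `A` itself. Rapidly decaying Fourier series give
polynomially bounded self-adjoint elements a smooth functional calculus with values in `A`
(`IsPolyBoundedElem.exists_map_eq_cfc`).

For closed `C` and `J ∉ C`, take `x ∈ ker(C)` outside `J` and approximate `x* x` by a polynomially
bounded `b`, which need not lie in `ker(C)`. Smooth functions of `b` vanishing near `0` do lie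
there: such a `g` equals `g u b` with `u` bounded, and replacing `b` by `x* x` costs only a
quasi-invertible factor (`mem_of_sub_mul_mem`). Two nested cutoffs `g`, `f` satisfy `g f = f`.
Finally `f ∉ J`, since `τ (x - x f)` is small, while norms on the coset of `x` modulo `J` are
bounded below (`Prim.exists_pos_le_norm`). -/

/-! ### Fourier series and absolute summability -/

/-- A smooth function on the line agrees on `[-R, R]` with a Fourier series whose coefficients
decrease rapidly. -/
theorem exists_fourier_expansion {f : ℝ → ℝ} (hf : ContDiff ℝ ∞ f) {R : ℝ} (hR : 0 < R) :
    ∃ (a : ℤ → ℂ) (s : ℤ → ℝ), (∀ k : ℕ, Summable fun n => (1 + |s n|) ^ k * ‖a n‖) ∧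
      ∀ t : ℝ, |t| ≤ R → HasSum (fun n => a n * exp (I * s n * t)) (f t : ℂ) := by
  -- With period `4R`, `|t| ≤ R` rescales to `|t / L| ≤ 1/4`, where `χ = 1`; all nonzero integer
  -- translates fall outside radius `1/2`. Poisson summation then returns `f t` alone.
  let χ : ContDiffBump (0 : ℝ) := ⟨1 / 4, 1 / 2, by norm_num, by norm_num⟩
  let L : ℝ := 4 * R
  have hL : 0 < L := by positivity
  let F : ℝ → ℂ := fun x => ((χ x * f (L * x) : ℝ) : ℂ)
  have hFc : HasCompactSupport F := by
    have h1 : HasCompactSupport fun x => χ x * f (L * x) := χ.hasCompactSupport.mul_right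
    exact h1.comp_left (g := fun x : ℝ => (x : ℂ)) ofReal_zero
  have hFs : ContDiff ℝ ∞ F :=
    ofRealCLM.contDiff.comp (χ.contDiff.mul (hf.comp (contDiff_const.mul contDiff_id)))
  let S : 𝓢(ℝ, ℂ) := hFc.toSchwartzMap hFs
  have hsum : ∀ k : ℕ, Summable fun n : ℤ => (1 + |2 * Real.pi / L * n|) ^ k * ‖𝓕 S (n : ℝ)‖ := by
    intro k
    let D := 1 + 2 * Real.pi / L
    have hD : 0 ≤ 2 * Real.pi / L := by positivity
    -- The two extra powers of decay pay for summing over `n`.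
    let C := 2 ^ (k + 2) * ((Finset.Iic (k + 2, 0)).sup
      fun m => SchwartzMap.seminorm ℂ m.1 m.2) (𝓕 S)
    have hb : ∀ n : ℤ, (1 + |(n : ℝ)|) ^ (k + 2) * ‖𝓕 S (n : ℝ)‖ ≤ C := by
      intro n
      have := SchwartzMap.one_add_le_sup_seminorm_apply (𝕜 := ℂ) (m := (k + 2, 0)) le_rfl le_rfl
        (𝓕 S) (n : ℝ)
      simpa [C] using this
    have h2 : Summable fun n : ℤ => D ^ k * C * |(n : ℝ)| ^ (-2 : ℝ) :=
      (Real.summable_abs_int_rpow (by norm_num : (1 : ℝ) < 2)).mul_left _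
    refine Summable.of_norm_bounded_eventually h2 ?_
    have : ∀ᶠ n : ℤ in cofinite, n ≠ 0 := (Set.finite_singleton 0).compl_mem_cofinite
    filter_upwards [this] with n hn
    have hn' : 0 < |(n : ℝ)| := by positivity
    have h3 : (1 + |2 * Real.pi / L * n|) ≤ D * (1 + |(n : ℝ)|) := by
      rw [abs_mul, abs_of_nonneg hD]
      simp only [D]
      nlinarith
    rw [Real.norm_of_nonneg (by positivity), Real.rpow_neg hn'.le, ← div_eq_mul_inv,
      le_div_iff₀ (by positivity)]
    calc (1 + |2 * Real.pi / L * n|) ^ k * ‖𝓕 S (n : ℝ)‖ * |(n : ℝ)| ^ (2 : ℝ)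
        ≤ (D * (1 + |(n : ℝ)|)) ^ k * ‖𝓕 S (n : ℝ)‖ * (1 + |(n : ℝ)|) ^ 2 := by
          rw [Real.rpow_two]
          gcongr
          linarith
      _ = D ^ k * ((1 + |(n : ℝ)|) ^ (k + 2) * ‖𝓕 S (n : ℝ)‖) := by
          rw [mul_pow]
          ring
      _ ≤ D ^ k * C := by
          gcongr
          exact hb n
  refine ⟨fun n => 𝓕 S (n : ℝ), fun n => 2 * Real.pi / L * n, hsum, fun t ht => ?_⟩
  have hs : Summable fun n : ℤ =>
      𝓕 S (n : ℝ) * exp (I * (2 * Real.pi / L * n : ℝ) * t) := by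
    refine Summable.of_norm ?_
    have h0 := hsum 0
    simp only [pow_zero, one_mul] at h0
    refine h0.congr fun n => ?_
    rw [norm_mul, show I * (2 * Real.pi / L * n : ℝ) * t
      = ((2 * Real.pi / L * n * t : ℝ) : ℂ) * I by push_cast; ring, norm_exp_ofReal_mul_I, mul_one]
  convert hs.hasSum using 1
  have hp := S.tsum_eq_tsum_fourier (t / L)
  have hx : |t / L| ≤ 1 / 4 := by
    rw [abs_div, abs_of_pos hL, div_le_iff₀ hL]
    simp only [L]
    linarith
  have hleft : ∑' n : ℤ, S (t / L + n) = (f t : ℂ) := by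
    rw [tsum_eq_single 0]
    · change F (t / L + (0 : ℤ)) = _
      have : χ (t / L) = 1 := χ.one_of_mem_closedBall (by
        rwa [Metric.mem_closedBall, Real.dist_0_eq_abs])
      simp only [F, Int.cast_zero, add_zero, this, one_mul]
      rw [mul_div_cancel₀ _ hL.ne']
    · intro n hn
      change F (t / L + n) = 0
      have h1 : (1 : ℝ) ≤ |(n : ℝ)| := by exact_mod_cast Int.one_le_abs hn
      have : χ (t / L + n) = 0 := by
        refine χ.zero_of_le_dist ?_
        change 1 / 2 ≤ dist (t / L + n) 0
        rw [Real.dist_0_eq_abs]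
        have h2 : |(n : ℝ)| ≤ |t / L + n| + |t / L| := by
          have := abs_sub (t / L + n) (t / L)
          simpa using this
        linarith
      simp [F, this]
  rw [← hleft, hp]
  refine tsum_congr fun n => ?_
  rw [fourier_coe_apply]
  congr 2
  push_cast
  field_simp

/-- In a complete space, a series converges if it converges absolutely for each seminorm. -/
theorem summable_of_summable_seminorm {E ι κ : Type*} [AddCommGroup E] [Module ℂ E]
    [UniformSpace E] [IsUniformAddGroup E] [CompleteSpace E] {p : κ → Seminorm ℂ E}
    (hp : WithSeminorms p) {x : ι → E} (hx : ∀ k, Summable fun i => p k (x i)) :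
    Summable x := by
  rw [summable_iff_vanishing]
  intro e he
  obtain ⟨s, r, hr, hsr⟩ := (hp.mem_nhds_iff 0 e).1 he
  have hsum : Summable fun i => (s.sup p) (x i) := by
    refine Summable.of_nonneg_of_le (fun i => apply_nonneg _ _) (fun i => ?_)
      (summable_sum (s := s) fun k _ => hx k)
    have : s.sup p ≤ ∑ k ∈ s, p k := Seminorm.finset_sup_le_sum p s
    simpa using this (x i)
  obtain ⟨t, ht⟩ := summable_iff_vanishing.1 hsum _ (Metric.ball_mem_nhds 0 hr)
  refine ⟨t, fun t' h' => hsr ?_⟩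
  rw [Seminorm.mem_ball, sub_zero]
  refine lt_of_le_of_lt
    (Finset.le_sum_of_subadditive _ (map_zero _).le (map_add_le_add (s.sup p)) t' x) ?_
  have := ht t' h'
  rw [Metric.mem_ball, Real.dist_0_eq_abs] at this
  exact (le_abs_self _).trans_lt this

/-! ### Primitive ideals and spectral inclusion -/

section Primitive

variable {A : Type u} [NonUnitalRing A] [Module ℂ A]

theorem one_mem_quasispectrum_iff {a : A} :
    (1 : ℂ) ∈ quasispectrum ℂ a ↔ ¬ IsQuasiregular (-a) := by
  simp [quasispectrum]

/-- A quasi-inverse `y` of `-a` satisfies `y - a - y a = 0`; applied to the fixed vector `v` this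
reads `-v = 0`. -/
theorem one_mem_quasispectrum {V : Type*} [AddCommGroup V] [Module ℂ V]
    (T : A →ₙₐ[ℂ] Module.End ℂ V) {a : A} {v : V} (hv : v ≠ 0) (h : T a v = v) :
    (1 : ℂ) ∈ quasispectrum ℂ a := by
  rw [one_mem_quasispectrum_iff, isQuasiregular_iff]
  rintro ⟨y, -, hy⟩
  have := congrArg (fun b => T b v) hy
  simp [h] at this
  exact hv this

theorem IsAlgIrreducible.exists_apply_eq {V : Type*} [AddCommGroup V] [Module ℂ V]
    {T : A →ₙₐ[ℂ] Module.End ℂ V} (hT : IsAlgIrreducible T) {v : V} (hv : v ≠ 0) (w : V) :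
    ∃ a, T a v = w := by
  let W : Submodule ℂ V :=
    { carrier := {w | ∃ a, T a v = w}
      zero_mem' := ⟨0, by simp⟩
      add_mem' := by
        rintro _ _ ⟨a, rfl⟩ ⟨b, rfl⟩
        exact ⟨a + b, by simp⟩
      smul_mem' := by
        rintro c _ ⟨a, rfl⟩
        exact ⟨c • a, by simp⟩ }
  rcases hT.2 W (by rintro a _ ⟨b, rfl⟩; exact ⟨a * b, by simp⟩) with h | h
  · obtain ⟨y, hy⟩ := hT.1
    obtain ⟨a, ha⟩ := hT.exists_apply_ne_zero hv hy
    have : T y (T a v) ∈ W := ⟨y * a, by simp⟩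
    rw [h] at this
    exact absurd ((Submodule.mem_bot ℂ).1 this) ha
  · exact (h ▸ Submodule.mem_top : w ∈ W)

/-- If a homomorphism does not shrink spectra, it is bounded below on each coset of a primitive
ideal other than the ideal itself. -/
theorem Prim.exists_pos_le_norm {U : Type*} [NormedRing U] [NormOneClass U] [NormedAlgebra ℂ U]
    [CompleteSpace U] {τ : A →ₙₐ[ℂ] U} (hτ : ∀ a, quasispectrum ℂ a ⊆ spectrum ℂ (τ a))
    (J : Prim A) {a : A} (ha : a ∉ J.1) :
    ∃ δ > 0, ∀ a', a - a' ∈ J.1 → δ ≤ ‖τ a'‖ := by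
  obtain ⟨V, _, _, T, hT, hJ⟩ := J.2
  rw [hJ] at ha
  obtain ⟨w, hw⟩ : ∃ w, T a w ≠ 0 := by
    by_contra! h
    exact ha (LinearMap.ext h)
  have hw0 : w ≠ 0 := by
    rintro rfl
    simp at hw
  -- For every `a'` in the coset of `a`, `x a'` fixes `w`, so `1` lies in the spectrum of `τ (x
  -- a')`.
  obtain ⟨x, hx⟩ := hT.exists_apply_eq hw w
  have key : ∀ a', a - a' ∈ J.1 → 1 ≤ ‖τ x‖ * ‖τ a'‖ := by
    intro a' h
    rw [hJ, map_sub, sub_eq_zero] at h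
    have h1 := hτ _ (one_mem_quasispectrum T (a := x * a') hw0 (by simp [← h, hx]))
    have h2 := spectrum.norm_le_norm_of_mem h1
    rw [norm_one, map_mul] at h2
    exact h2.trans (norm_mul_le _ _)
  have hpos : 0 < ‖τ x‖ := by
    refine (norm_nonneg _).lt_of_ne fun h => ?_
    have := key a (by simp)
    rw [← h, zero_mul] at this
    linarith
  refine ⟨‖τ x‖⁻¹, inv_pos.2 hpos, fun a' h => ?_⟩
  rw [inv_le_iff_one_le_mul₀' hpos]
  exact key a' h

/-- The norm estimate is in `U`, but spectral inclusion makes `1 - y` invertible over `A`;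
multiplying `c (1 - y)` by the inverse recovers `c` inside the ideal. -/
theorem mem_of_sub_mul_mem {U : Type*} [NormedRing U] [NormOneClass U] [NormedAlgebra ℂ U]
    [CompleteSpace U] {τ : A →ₙₐ[ℂ] U} (hτ : ∀ a, quasispectrum ℂ a ⊆ spectrum ℂ (τ a))
    (J : TwoSidedIdeal A) {c y : A} (hy : ‖τ y‖ < 1) (h : c - c * y ∈ J) : c ∈ J := by
  have hq : IsQuasiregular (-y) := by
    by_contra hn
    have := spectrum.norm_le_norm_of_mem (hτ _ (one_mem_quasispectrum_iff.2 hn))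
    rw [norm_one] at this
    linarith
  obtain ⟨z, hz, -⟩ := isQuasiregular_iff.1 hq
  have h1 : (c - c * y) + (c - c * y) * z ∈ J := J.add_mem h (J.mul_mem_right _ _ h)
  have h2 : (c - c * y) + (c - c * y) * z = c + c * (z + -y + -y * z) := by
    noncomm_ring
  rwa [h2, hz, mul_zero, add_zero] at h1

theorem injective_of_isSemisimpleAlg {U : Type*} [NormedRing U] [NormOneClass U]
    [NormedAlgebra ℂ U] [CompleteSpace U] {τ : A →ₙₐ[ℂ] U}
    (hτ : ∀ a, quasispectrum ℂ a ⊆ spectrum ℂ (τ a)) (hss : IsSemisimpleAlg A) :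
    Function.Injective τ := by
  rw [injective_iff_map_eq_zero]
  refine fun a ha => hss a fun J => ?_
  by_contra hJ
  obtain ⟨δ, hδ, h⟩ := J.exists_pos_le_norm hτ hJ
  have := h a (by simp)
  rw [ha, norm_zero] at this
  linarith

end Primitive

/-! ### Smooth functional calculus -/

section FunctionalCalculus

variable {A : Type u} [NonUnitalRing A] [Module ℂ A]

theorem map_powSucc {U : Type*} [Ring U] [Module ℂ U] (τ : A →ₙₐ[ℂ] U) (a : A) (n : ℕ) :
    τ (powSucc a n) = τ a ^ (n + 1) := by
  induction n with
  | zero => simp [powSucc]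
  | succ n ih => rw [powSucc, map_mul, ih, ← pow_succ]

theorem map_expSubOne [TopologicalSpace A] {U : Type*} [NormedRing U] [NormedAlgebra ℂ U]
    [CompleteSpace U] {τ : A →ₙₐ[ℂ] U} (hτ : Continuous τ) {a : A} (ha : Summable (expTerm a)) :
    τ (expSubOne a) = NormedSpace.exp (τ a) - 1 := by
  have h1 : HasSum (fun n => τ (expTerm a n)) (τ (expSubOne a)) := ha.hasSum.map τ hτ
  have h2 := (hasSum_nat_add_iff' 1).2 (NormedSpace.exp_series_hasSum_exp' (𝕂 := ℂ) (τ a))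
  simp only [Finset.sum_range_one, pow_zero, Nat.factorial_zero, Nat.cast_one, inv_one,
    one_smul] at h2
  simp only [expTerm, map_smul, map_powSucc] at h1
  exact h1.unique h2

/-- Smooth functional calculus for polynomially bounded self-adjoint elements. -/
theorem IsPolyBoundedElem.exists_map_eq_cfc [UniformSpace A] [IsUniformAddGroup A]
    [CompleteSpace A] [StarRing A] {p : ℕ → Seminorm ℂ A} (hp : WithSeminorms p)
    {U : Type*} [CStarAlgebra U] {τ : A →⋆ₙₐ[ℂ] U} (hτ : Continuous τ) {b : A}
    (hpb : IsPolyBoundedElem p b) (hb : IsSelfAdjoint b) {f : ℝ → ℝ} (hf : ContDiff ℝ ∞ f)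
    (hf0 : f 0 = 0) : ∃ c, τ c = cfc f (τ b) := by
  have hS : IsSelfAdjoint (τ b) := hb.map τ
  have hSn : IsStarNormal (τ b) := hS.isStarNormal
  obtain ⟨a, s, has, haf⟩ := exists_fourier_expansion hf (R := ‖τ b‖ * ‖(1 : U)‖ + 1)
    (by positivity)
  have ha : Summable fun n => ‖a n‖ := by simpa using has 0
  -- Each exponential lacks its constant term, as `A` may have no identity; the missing constants
  -- sum to `f 0 = 0`.
  let x : ℤ → A := fun n => a n • expSubOne ((I * (s n : ℂ)) • b)
  have hx : Summable x := by
    refine summable_of_summable_seminorm hp fun k => ?_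
    obtain ⟨c, hc, hck⟩ := hpb.2 k
    refine Summable.of_nonneg_of_le (fun n => apply_nonneg _ _) (fun n => ?_)
      ((has ⌈c⌉₊).mul_left c)
    have h1 : (1 : ℝ) ≤ 1 + |s n| := by linarith [abs_nonneg (s n)]
    calc p k (x n) = ‖a n‖ * p k (expSubOne ((I * (s n : ℂ)) • b)) := map_smul_eq_mul _ _ _
      _ ≤ ‖a n‖ * (c * (1 + |s n|) ^ (⌈c⌉₊ : ℝ)) := by
          gcongr
          refine (hck (s n)).trans ?_
          gcongr
          exact Nat.le_ceil c
      _ = c * ((1 + |s n|) ^ ⌈c⌉₊ * ‖a n‖) := by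
          rw [Real.rpow_natCast]
          ring
  let φ : ℤ → ℂ → ℂ := fun n z => a n * exp (I * s n * z) - a n
  have hφ : ∀ n, τ (x n) = cfc (φ n) (τ b) := by
    intro n
    have h1 : τ (expSubOne ((I * (s n : ℂ)) • b)) = NormedSpace.exp ((I * (s n : ℂ)) • τ b) - 1 := by
      have := map_expSubOne (τ := (τ : A →ₙₐ[ℂ] U)) hτ (hpb.1 (s n))
      rw [map_smul] at this
      exact this
    have h2 : NormedSpace.exp ((I * (s n : ℂ)) • τ b) = cfc (fun z => exp (I * s n * z)) (τ b) := by
      have h3 : IsStarNormal ((I * (s n : ℂ)) • τ b) := inferInstance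
      rw [← CFC.complex_exp_eq_normedSpace_exp h3, ← cfc_comp_smul _ _ _ (by fun_prop) hSn]
      rfl
    have h4 : cfc (φ n) (τ b) = cfc (fun z => a n * exp (I * s n * z)) (τ b)
        - cfc (fun _ => a n) (τ b) := cfc_sub _ _ _ (by fun_prop) (by fun_prop)
    rw [h4, cfc_const_mul _ _ _ (by fun_prop), cfc_const _ _ hSn, ← h2]
    simp only [x, map_smul, h1, smul_sub, Algebra.algebraMap_eq_smul_one]
  refine ⟨∑' n, x n, ?_⟩
  have h1 : HasSum (fun n => cfc (φ n) (τ b)) (τ (∑' n, x n)) := by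
    have := hx.hasSum.map τ hτ
    exact this.congr_fun fun n => (hφ n).symm
  have hspec : ∀ z ∈ spectrum ℂ (τ b), ∃ t : ℝ, z = t ∧ |t| ≤ ‖τ b‖ * ‖(1 : U)‖ + 1 := by
    intro z hz
    have hre := hS.mem_spectrum_eq_re hz
    refine ⟨z.re, hre, (Complex.abs_re_le_norm z).trans ?_⟩
    linarith [spectrum.norm_le_norm_mul_of_mem hz]
  have hunif : TendstoUniformlyOn (fun (t : Finset ℤ) z => ∑ n ∈ t, φ n z)
      (fun z => (f z.re : ℂ)) atTop (spectrum ℂ (τ b)) := by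
    have := tendstoUniformlyOn_tsum (f := φ) (s := spectrum ℂ (τ b)) (ha.mul_left 2) ?_
    · refine this.congr_right fun z hz => ?_
      obtain ⟨t, rfl, ht⟩ := hspec z hz
      have h0 := haf 0 (by rw [abs_zero]; positivity)
      simp only [ofReal_zero, mul_zero, exp_zero, mul_one, hf0] at h0
      have := (haf t ht).sub h0
      rw [sub_zero] at this
      exact this.tsum_eq
    · intro n z hz
      obtain ⟨t, rfl, ht⟩ := hspec z hz
      refine (norm_sub_le _ _).trans ?_
      rw [norm_mul, show I * (s n : ℂ) * (t : ℂ) = ((s n * t : ℝ) : ℂ) * I by push_cast; ring,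
        norm_exp_ofReal_mul_I]
      linarith
  have h2 : Tendsto (fun t : Finset ℤ => cfc (fun z => ∑ n ∈ t, φ n z) (τ b)) atTop
      (𝓝 (cfc (fun z : ℂ => (f z.re : ℂ)) (τ b))) :=
    tendsto_cfc_fun hunif (.of_forall fun t => by fun_prop)
  rw [cfc_real_eq_complex f hS]
  refine tendsto_nhds_unique (f := fun t : Finset ℤ => ∑ n ∈ t, cfc (φ n) (τ b)) h1 ?_
  refine h2.congr fun t => ?_
  rw [← cfc_sum φ (τ b) t fun n _ => by fun_prop]
  congr 1
  ext z
  simp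

end FunctionalCalculus

/-! ### Cutoff functions -/

section Cutoff

/-- A smooth function that vanishes on `[-r, r]` and equals `1` off `[-2r, 2r]`. -/
noncomputable def cutoff (r t : ℝ) : ℝ := Real.smoothTransition ((t / r) ^ 2 - 1)

/-- A smooth function that vanishes on `[-r, r]` and equals `1 / t` off `[-2r, 2r]`. -/
noncomputable def cutoffInv (r t : ℝ) : ℝ := cutoff r t * t / (t ^ 2 + (1 - cutoff r t))

theorem contDiff_cutoff (r : ℝ) : ContDiff ℝ ∞ (cutoff r) :=
  Real.smoothTransition.contDiff.comp (((contDiff_id.div_const r).pow 2).sub contDiff_const)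

theorem cutoff_nonneg (r t : ℝ) : 0 ≤ cutoff r t := Real.smoothTransition.nonneg _

theorem cutoff_le_one (r t : ℝ) : cutoff r t ≤ 1 := Real.smoothTransition.le_one _

variable {r t : ℝ}

theorem cutoff_eq_zero (hr : 0 < r) (ht : |t| ≤ r) : cutoff r t = 0 := by
  refine Real.smoothTransition.zero_of_nonpos ?_
  have : |t / r| ≤ 1 := by
    rw [abs_div, abs_of_pos hr]
    exact div_le_one_of_le₀ ht hr.le
  linarith [(sq_le_one_iff_abs_le_one _).2 this]

theorem cutoff_eq_one (hr : 0 < r) (ht : 2 * r ≤ |t|) : cutoff r t = 1 := by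
  refine Real.smoothTransition.one_of_one_le ?_
  have : 2 ≤ |t / r| := by
    rw [abs_div, abs_of_pos hr, le_div_iff₀ hr]
    exact ht
  nlinarith [sq_abs (t / r)]

theorem cutoff_mul_cutoff (hr : 0 < r) (t : ℝ) : cutoff r t * cutoff (2 * r) t = cutoff (2 * r) t := by
  rcases le_total |t| (2 * r) with h | h
  · rw [cutoff_eq_zero (by positivity) h, mul_zero]
  · rw [cutoff_eq_one hr h, one_mul]

/-- The summand `1 - cutoff r t` keeps the denominator positive at `0` and disappears where the
quotient has to be `1 / t`. -/
theorem cutoffInv_denom_pos (hr : 0 < r) (t : ℝ) : 0 < t ^ 2 + (1 - cutoff r t) := by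
  rcases eq_or_ne t 0 with rfl | ht
  · rw [cutoff_eq_zero hr (by simpa using hr.le)]
    norm_num
  · have := cutoff_le_one r t
    have : 0 < t ^ 2 := by positivity
    linarith

theorem contDiff_cutoffInv (hr : 0 < r) : ContDiff ℝ ∞ (cutoffInv r) :=
  ((contDiff_cutoff r).mul contDiff_id).div
    ((contDiff_id.pow 2).add (contDiff_const.sub (contDiff_cutoff r)))
    fun t => (cutoffInv_denom_pos hr t).ne'

theorem abs_cutoffInv_le (hr : 0 < r) (t : ℝ) : |cutoffInv r t| ≤ r⁻¹ := by
  rcases le_total |t| r with h | h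
  · rw [cutoffInv, cutoff_eq_zero hr h]
    simpa using hr.le
  · have h0 := cutoff_nonneg r t
    have h1 := cutoff_le_one r t
    rw [cutoffInv, abs_div, abs_mul, abs_of_nonneg h0, abs_of_pos (cutoffInv_denom_pos hr t),
      div_le_iff₀ (cutoffInv_denom_pos hr t), ← div_eq_inv_mul, le_div_iff₀ hr]
    calc cutoff r t * |t| * r ≤ 1 * |t| * |t| := by gcongr
      _ = t ^ 2 := by rw [one_mul, ← sq, sq_abs]
      _ ≤ _ := by linarith

theorem cutoff_mul_cutoffInv_mul (hr : 0 < r) (t : ℝ) :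
    cutoff (2 * r) t * (cutoffInv r t * t) = cutoff (2 * r) t := by
  rcases le_total |t| (2 * r) with h | h
  · rw [cutoff_eq_zero (by positivity) h, zero_mul]
  · have ht : t ≠ 0 := by
      rintro rfl
      rw [abs_zero] at h
      linarith
    rw [cutoffInv, cutoff_eq_one hr h]
    field_simp
    simp

theorem abs_one_sub_cutoff_mul_le (hr : 0 < r) (t : ℝ) :
    |(1 - cutoff r t) * (t * (1 - cutoff r t))| ≤ 2 * r := by
  rcases le_total |t| (2 * r) with h | h
  · have h0 : |1 - cutoff r t| ≤ 1 := by
      rw [abs_le]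
      constructor <;> linarith [cutoff_nonneg r t, cutoff_le_one r t]
    rw [abs_mul, abs_mul]
    calc |1 - cutoff r t| * (|t| * |1 - cutoff r t|) ≤ 1 * (2 * r * 1) := by gcongr
      _ = 2 * r := by ring
  · rw [cutoff_eq_one hr h]
    simpa using hr.le

end Cutoff

/-! ### Separating a primitive ideal from a closed set -/

/-- With `q = 1 - cfc (cutoff r) S`, the C*-identity turns the square into the norm of `q (x* x) q`.
Replacing `x* x` by `S` costs `ε`, and `q` lives on `|t| ≤ 2r`. -/
theorem norm_one_sub_cfc_cutoff_sq_le {U : Type*} [CStarAlgebra U] {S x : U}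
    (hS : IsSelfAdjoint S) {r ε : ℝ} (hr : 0 < r) (h : ‖star x * x - S‖ ≤ ε) :
    ‖x * (1 - cfc (cutoff r) S)‖ ^ 2 ≤ 2 * r + ε := by
  have hc : Continuous (cutoff r) := (contDiff_cutoff r).continuous
  have hε : 0 ≤ ε := (norm_nonneg _).trans h
  set q : U := 1 - cfc (cutoff r) S with hq
  have hqe : q = cfc (fun t => 1 - cutoff r t) S := by
    rw [cfc_sub _ _ S (by fun_prop) (by fun_prop), cfc_const_one ℝ S]
  have hqs : star q = q := by
    rw [hqe]
    exact IsSelfAdjoint.cfc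
  have hqn : ‖q‖ ≤ 1 := by
    rw [hqe]
    refine norm_cfc_le zero_le_one fun t _ => ?_
    rw [Real.norm_eq_abs, abs_le]
    constructor <;> linarith [cutoff_nonneg r t, cutoff_le_one r t]
  have h1 : ‖q * (S * q)‖ ≤ 2 * r := by
    have : q * (S * q) = cfc (fun t => (1 - cutoff r t) * (t * (1 - cutoff r t))) S := by
      rw [cfc_mul _ _ S (by fun_prop) (by fun_prop), cfc_mul _ _ S (by fun_prop) (by fun_prop),
        cfc_id' ℝ S, ← hqe]
    rw [this]
    exact norm_cfc_le (by positivity) fun t _ => abs_one_sub_cutoff_mul_le hr t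
  have h2 : star (x * q) * (x * q) = q * (S * q) + q * ((star x * x - S) * q) := by
    rw [star_mul, hqs]
    noncomm_ring
  rw [sq, ← CStarRing.norm_star_mul_self, h2]
  refine (norm_add_le _ _).trans (add_le_add h1 ?_)
  calc ‖q * ((star x * x - S) * q)‖ ≤ ‖q‖ * (‖star x * x - S‖ * ‖q‖) :=
        (norm_mul_le _ _).trans (by gcongr; exact norm_mul_le _ _)
    _ ≤ 1 * (ε * 1) := by gcongr
    _ = ε := by ring

theorem isHullKernelRegular_of_map {A : Type u} [NonUnitalRing A] [Module ℂ A]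
    [IsScalarTower ℂ A A] [SMulCommClass ℂ A A] [StarRing A]
    [UniformSpace A] [IsUniformAddGroup A] [CompleteSpace A]
    {p : ℕ → Seminorm ℂ A} (hp : WithSeminorms p) (hss : IsSemisimpleAlg A)
    {U : Type*} [CStarAlgebra U] [Nontrivial U] {τ : A →⋆ₙₐ[ℂ] U} (hτc : Continuous τ)
    (hτ : ∀ a, quasispectrum ℂ a ⊆ spectrum ℂ (τ a)) (hpb : IsPolyBoundedAlgebra p) :
    IsHullKernelRegular A := by
  intro C hC J hJ
  have hinj : Function.Injective τ :=
    injective_of_isSemisimpleAlg (τ := (τ : A →ₙₐ[ℂ] U)) hτ hss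
  obtain ⟨x, hxC, hxJ⟩ : ∃ x ∈ kernel C, x ∉ J.1 := by
    by_contra! h
    rw [isClosed_iff_hull_kernel] at hC
    exact hJ (hC ▸ h)
  obtain ⟨δ, hδ, hδx⟩ := J.exists_pos_le_norm (τ := (τ : A →ₙₐ[ℂ] U)) hτ hxJ
  -- The outermost cutoff has `r = 4ε`, so the final bound is `2r + ε = 9ε`, strictly below `δ ^ 2 =
  -- 10ε`.
  let ε := δ ^ 2 / 10
  have hε : 0 < ε := by positivity
  obtain ⟨b, hbε, hb, hbp⟩ := mem_closure_iff.1 (hpb (IsSelfAdjoint.star_mul_self x))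
    (τ ⁻¹' Metric.ball (τ (star x * x)) ε) (Metric.isOpen_ball.preimage hτc)
    (Metric.mem_ball_self hε)
  rw [Set.mem_preimage, mem_ball_iff_norm, ← map_sub] at hbε
  have hS : IsSelfAdjoint (τ b) := hb.map τ
  have hzero : ∀ r > 0, cutoff r 0 = 0 := fun r hr => cutoff_eq_zero hr (by simpa using hr.le)
  have hcut : ∀ r, Continuous (cutoff r) := fun r => (contDiff_cutoff r).continuous
  have hinv : Continuous (cutoffInv ε) := (contDiff_cutoffInv hε).continuous
  -- Scales `ε`, `2ε`, `4ε` for `u`, `g`, `f`: each doubling makes the previous function equal to `1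
  -- / t` or `1` wherever the next is nonzero.
  obtain ⟨g, hg⟩ := hbp.exists_map_eq_cfc hp hτc hb (contDiff_cutoff (2 * ε))
    (hzero _ (by positivity))
  obtain ⟨f, hf⟩ := hbp.exists_map_eq_cfc hp hτc hb (contDiff_cutoff (2 * (2 * ε)))
    (hzero _ (by positivity))
  obtain ⟨u, hu⟩ := hbp.exists_map_eq_cfc hp hτc hb (contDiff_cutoffInv hε) (by simp [cutoffInv])
  refine ⟨f, g, fun J' hJ' => ?_, fun hfJ => ?_, hinj ?_⟩
  · have hgu : g * (u * b) = g := by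
      refine hinj ?_
      rw [map_mul, map_mul, hg, hu]
      nth_rw 3 [← cfc_id' ℝ (τ b)]
      rw [← cfc_mul _ _ (τ b) (by fun_prop) (by fun_prop),
        ← cfc_mul _ _ (τ b) (by fun_prop) (by fun_prop)]
      simp only [cutoff_mul_cutoffInv_mul hε]
    refine mem_of_sub_mul_mem (τ := (τ : A →ₙₐ[ℂ] U)) hτ J'.1 (y := u * (b - star x * x)) ?_ ?_
    · change ‖τ _‖ < 1
      rw [map_mul]
      calc ‖τ u * τ (b - star x * x)‖ ≤ ‖τ u‖ * ‖τ (b - star x * x)‖ := norm_mul_le _ _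
        _ ≤ ε⁻¹ * ‖τ (b - star x * x)‖ := by
            gcongr
            rw [hu]
            exact norm_cfc_le (by positivity) fun t _ => abs_cutoffInv_le hε t
        _ < ε⁻¹ * ε := by gcongr
        _ = 1 := inv_mul_cancel₀ hε.ne'
    · have : g - g * (u * (b - star x * x)) = g * (u * (star x * x)) := by
        nth_rw 1 [← hgu]
        noncomm_ring
      rw [this]
      exact J'.1.mul_mem_left _ _ (J'.1.mul_mem_left _ _ (J'.1.mul_mem_left _ _ (hxC J' hJ')))
  · have h1 : δ ≤ ‖τ (x - x * f)‖ := hδx _ (by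
      rw [sub_sub_cancel]
      exact J.1.mul_mem_left _ _ hfJ)
    have h2 := norm_one_sub_cfc_cutoff_sq_le (x := τ x) (ε := ε) hS
      (by positivity : 0 < 2 * (2 * ε)) (by
        rw [← map_star, ← map_mul, ← map_sub, ← neg_sub, map_neg, norm_neg]
        exact hbε.le)
    rw [mul_sub, mul_one, ← hf, ← map_mul, ← map_sub] at h2
    have h3 : δ ^ 2 ≤ ‖τ (x - x * f)‖ ^ 2 := by gcongr
    have h4 : δ ^ 2 = 10 * ε := by simp only [ε]; ring
    linarith
  · rw [map_mul, hg, hf, ← cfc_mul _ _ (τ b) (by fun_prop) (by fun_prop)]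
    simp only [cutoff_mul_cutoff (by positivity : 0 < 2 * ε)]

end HullKernel

theorem theorem3p10 {A : Type u} [NonUnitalRing A] [Module ℂ A]
    [IsScalarTower ℂ A A] [SMulCommClass ℂ A A] [StarRing A] [StarModule ℂ A]
    [UniformSpace A] [IsUniformAddGroup A] [T2Space A] [CompleteSpace A]
    [ContinuousMul A] [ContinuousStar A]
    (p : ℕ → Seminorm ℂ A) (hp : WithSeminorms p)
    (hss : HullKernel.IsSemisimpleAlg A)
    (hqs : HullKernel.IsQuasiSymmetric.{u, v} A)
    (hpb : HullKernel.IsPolyBoundedAlgebra p) :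
    HullKernel.IsHullKernelRegular A := by
  obtain ⟨B, _, σ, hσ, hspec⟩ := hqs
  -- Passing to the unitization turns the quasispectrum of `σ a` into an ordinary spectrum.
  refine HullKernel.isHullKernelRegular_of_map hp hss
    (τ := (Unitization.inrNonUnitalStarAlgHom ℂ B).comp σ) ?_ (fun a => ?_) hpb
  · exact (Unitization.isometry_inr (𝕜 := ℂ)).continuous.comp hσ
  · exact (hspec a).trans (Unitization.quasispectrum_eq_spectrum_inr' ℂ ℂ (σ a)).subset
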